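/- Let $n\ge 0$ be an integer and let $Y(n)=Y(\mathfrak{gl}_n)$ be the Yangian, that is, the unital associative $\mathbb{C}$-algebra with generators $t_{ij}^{(r)}$, $1\le i,j\le n$, $r\ge 1$, and defining relations $$[t^{(r+1)}_{ij}, t^{(s)}_{kl}]-[t^{(r)}_{ij}, t^{(s+1)}_{kl}]=t^{(r)}_{kj} t^{(s)}_{il}-t^{(s)}_{kj} t^{(r)}_{il},\qquad 1\le i,j,k,l\le n,\ r,s\ge 0,$$ where $t^{(0)}_{ij}=\delta_{ij}$. Put $t_{ij}(u)=\sum_{r\ge 0}t_{ij}^{(r)}u^{-r}\in Y(n)[[u^{-1}]]$ and let $T(u)=(t_{ij}(u))_{i,j=1}^n$, an $n\times n$ matrix over $Y(n)[[u^{-1}]]$. Maps defined on $Y(n)$ are applied to series coefficientwise and to matrices entrywise. **Theorem.** The algebra $Y(n)$ carries the structure of a Hopf algebra over $\mathbb{C}$ (so the coproduct $\Delta$ and the counit $\epsilon$ are algebra homomorphisms) such that the antipode $\mathrm{S}$ is an anti-automorphism of $Y(n)$ and - the coproduct $\Delta: Y(n)\to Y(n)\otimes Y(n)$ satisfies $\Delta(t_{ij}(u))=\sum_{a=1}^n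 t_{ia}(u)\otimes t_{aj}(u)$, i.e. $\Delta(t_{ij}^{(r)})=\sum_{a=1}^n\sum_{p+q=r}t_{ia}^{(p)}\otimes t_{aj}^{(q)}$ for all $1\le i,j\le n$ and $r\ge 0$; - the matrix $T(u)$ is invertible and the antipode satisfies $\mathrm{S}(T(u))=T(u)^{-1}$, where $T(u)^{-1}$ is the two-sided inverse; - the counit $\epsilon: Y(n)\to\mathbb{C}$ satisfies $\epsilon(T(u))=1$, the identity matrix. -/

import Mathlib

open scoped TensorProduct

noncomputable section

namespace Yangian

/-- The free algebra on symbols `(i, j, r)`, where `(i, j, r)` stands for the generator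
`t_{ij}^{(r+1)}`. -/
abbrev Free (n : ℕ) : Type := FreeAlgebra ℂ (Fin n × Fin n × ℕ)

/-- The element `t_{ij}^{(r)}` of the free algebra, with the convention
`t_{ij}^{(0)} = δ_{ij}`. -/
def freeGen {n : ℕ} (i j : Fin n) : ℕ → Free n
  | 0 => if i = j then 1 else 0
  | r + 1 => FreeAlgebra.ι ℂ (i, j, r)

/-- The defining relations
`[t_{ij}^{(r+1)}, t_{kl}^{(s)}] - [t_{ij}^{(r)}, t_{kl}^{(s+1)}]
  = t_{kj}^{(r)} t_{il}^{(s)} - t_{kj}^{(s)} t_{il}^{(r)}` for all `r, s ≥ 0`;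
here `⁅a, b⁆ = a * b - b * a`. -/
inductive Rel (n : ℕ) : Free n → Free n → Prop
  | rel (i j k l : Fin n) (r s : ℕ) :
      Rel n
        (⁅freeGen i j (r + 1), freeGen k l s⁆ - ⁅freeGen i j r, freeGen k l (s + 1)⁆)
        (freeGen k j r * freeGen i l s - freeGen k j s * freeGen i l r)

end Yangian

/-- The Yangian `Y(n)` of `gl_n`, as a ring. -/
def Yangian (n : ℕ) : Type := RingQuot (Yangian.Rel n)

namespace Yangian

instance instRing (n : ℕ) : Ring (Yangian n) :=
  inferInstanceAs (Ring (RingQuot (Yangian.Rel n)))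

/-- The `ℂ`-algebra structure of `Y(n)` given by its presentation. It is not registered as an
instance: a Hopf algebra structure carries an algebra structure, and is required to carry
this one. -/
abbrev algebra (n : ℕ) : Algebra ℂ (Yangian n) :=
  inferInstanceAs (Algebra ℂ (RingQuot (Yangian.Rel n)))

/-- The element `t_{ij}^{(r)}` of `Y(n)`, for `r ≥ 0`. -/
def gen {n : ℕ} (i j : Fin n) (r : ℕ) : Yangian n :=
  RingQuot.mkRingHom (Yangian.Rel n) (freeGen i j r)

/-- The matrix `T(u)`, whose `(i, j)` entry is the formal series
`t_{ij}(u) = ∑_{r ≥ 0} t_{ij}^{(r)} u^{-r}`. The variable of `PowerSeries` stands for `u⁻¹`. -/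
def T (n : ℕ) : Matrix (Fin n) (Fin n) (PowerSeries (Yangian n)) :=
  Matrix.of fun i j => PowerSeries.mk fun r => gen i j r

end Yangian

/-- Apply a map `f : A → B` to each coefficient of each entry of a matrix of formal series. -/
def Matrix.mapCoeff {n : ℕ} {A B : Type} [Semiring A] (f : A → B)
    (M : Matrix (Fin n) (Fin n) (PowerSeries A)) : Matrix (Fin n) (Fin n) (PowerSeries B) :=
  Matrix.of fun i j => PowerSeries.mk fun r => f (PowerSeries.coeff r (M i j))

end

/-!
Let `P` be the flip of the two factors of `ℂⁿ ⊗ ℂⁿ` and `R(u) = u - P`. The defining relations of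
the Yangian are the coefficients of the RTT relation
`R(u - v) T₁(u) T₂(v) = T₂(v) T₁(u) R(u - v)`, so homomorphisms out of the Yangian are the same as
solutions `M(u)` of this relation with constant term `1`. The product of two solutions with
commuting entries is a solution, which gives the coproduct, and the identity matrix is a solution,
which gives the counit. Inverting the RTT relation shows that `T(u)⁻¹` is a solution over the
opposite algebra, which gives the antipode as an anti-homomorphism, and so is `T(-u)`.

The antipode is bijective because it is the composite of the two involutions `T(u) ↦ T(-u)` and
`T(u) ↦ T(-u)⁻¹`. The Hopf axioms hold on all of the Yangian once they hold on generators, where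
they say `T(u)⁻¹ T(u) = 1 = T(u) T(u)⁻¹`.
-/

noncomputable section

namespace Yangian

open Matrix PowerSeries

section RMatrix

variable {ι A : Type*} [Fintype ι] [DecidableEq ι]

section Semiring

variable [Semiring A]

variable (ι A) in
/-- The embedding `X ↦ X ⊗ 1`, written `X ↦ X₁` in the literature. The entry of `X ⊗ Y` in row
`(i, k)` and column `(j, l)` stands for `X i j * Y k l`. -/
def leftFactor : Matrix ι ι A →+* Matrix (ι × ι) (ι × ι) A :=
  (compRingEquiv ι ι A : _ →+* _).comp (scalar ι).mapMatrix

variable (ι A) in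
/-- The embedding `X ↦ 1 ⊗ X`, written `X ↦ X₂` in the literature. -/
def rightFactor : Matrix ι ι A →+* Matrix (ι × ι) (ι × ι) A :=
  (compRingEquiv ι ι A : _ →+* _).comp (scalar ι)

theorem leftFactor_apply (X : Matrix ι ι A) (i j k l : ι) :
    leftFactor ι A X (i, k) (j, l) = if k = l then X i j else 0 := by
  simp [leftFactor, diagonal_apply]

theorem rightFactor_apply (X : Matrix ι ι A) (i j k l : ι) :
    rightFactor ι A X (i, k) (j, l) = if i = j then X k l else 0 := by
  simp only [rightFactor, RingHom.comp_apply, RingHom.coe_coe, compRingEquiv_apply, comp_apply,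
    scalar_apply, diagonal_apply]
  split_ifs <;> rfl

theorem leftFactor_mul_rightFactor_apply (X Y : Matrix ι ι A) (i j k l : ι) :
    (leftFactor ι A X * rightFactor ι A Y) (i, k) (j, l) = X i j * Y k l := by
  simp [mul_apply, Fintype.sum_prod_type, leftFactor_apply, rightFactor_apply]

theorem rightFactor_mul_leftFactor_apply (X Y : Matrix ι ι A) (i j k l : ι) :
    (rightFactor ι A Y * leftFactor ι A X) (i, k) (j, l) = Y k l * X i j := by
  simp [mul_apply, Fintype.sum_prod_type, leftFactor_apply, rightFactor_apply]

theorem commute_leftFactor_rightFactor {X Y : Matrix ι ι A}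
    (h : ∀ i j k l, Commute (X i j) (Y k l)) :
    Commute (leftFactor ι A X) (rightFactor ι A Y) := by
  ext ⟨i, k⟩ ⟨j, l⟩
  rw [leftFactor_mul_rightFactor_apply, rightFactor_mul_leftFactor_apply, (h i j k l).eq]

end Semiring

variable [Ring A]

variable (ι) in
/-- The `R`-matrix `c - d P`, where `P` is the flip of the two tensor factors. -/
def rMatrix (c d : A) : Matrix (ι × ι) (ι × ι) A :=
  scalar _ c - scalar _ d * Equiv.Perm.permMatrix A (Equiv.prodComm ι ι)

theorem rMatrix_mul_apply (c d : A) (M : Matrix (ι × ι) (ι × ι) A) (i j k l : ι) :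
    (rMatrix ι c d * M) (i, k) (j, l) = c * M (i, k) (j, l) - d * M (k, i) (j, l) := by
  simp [rMatrix, sub_mul, mul_assoc, PEquiv.toMatrix_toPEquiv_mul]

theorem mul_rMatrix_apply {c d : A} (hc : ∀ a, Commute c a) (hd : ∀ a, Commute d a)
    (M : Matrix (ι × ι) (ι × ι) A) (i j k l : ι) :
    (M * rMatrix ι c d) (i, k) (j, l) = c * M (i, k) (j, l) - d * M (i, k) (l, j) := by
  rw [rMatrix, mul_sub, ← mul_assoc, ← (scalar_commute c hc M).eq, ← (scalar_commute d hd M).eq,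
    mul_assoc]
  simp [PEquiv.mul_toMatrix_toPEquiv]

theorem semiconjBy_rMatrix_iff {c d : A} (hc : ∀ a, Commute c a) (hd : ∀ a, Commute d a)
    {M N : Matrix (ι × ι) (ι × ι) A} :
    SemiconjBy (rMatrix ι c d) M N ↔ ∀ i j k l,
      c * (M (i, k) (j, l) - N (i, k) (j, l)) = d * (M (k, i) (j, l) - N (i, k) (l, j)) := by
  simp only [SemiconjBy, ← Matrix.ext_iff, Prod.forall, rMatrix_mul_apply,
    mul_rMatrix_apply hc hd, mul_sub, sub_eq_sub_iff_sub_eq_sub]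
  exact forall_congr' fun i => forall_comm

end RMatrix

section TwoVariables

variable {R : Type*}

section Semiring

variable [Semiring R]

variable (R) in
/-- The embedding `f(u) ↦ f(u)` of series in one variable into series in two variables. The inner
variable of `R⟦X⟧⟦X⟧` stands for `u⁻¹` and the outer one for `v⁻¹`. -/
def inU : R⟦X⟧ →+* R⟦X⟧⟦X⟧ := C

variable (R) in
/-- The embedding `f(u) ↦ f(v)` of series in one variable into series in two variables, with the
conventions of `inU`. -/
def inV : R⟦X⟧ →+* R⟦X⟧⟦X⟧ := PowerSeries.map C

theorem coeff_coeff_inU_mul_inV (f g : R⟦X⟧) (r s : ℕ) :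
    coeff r (coeff s (inU R f * inV R g)) = coeff r f * coeff s g := by
  simp [inU, inV]

theorem coeff_coeff_inV_mul_inU (f g : R⟦X⟧) (r s : ℕ) :
    coeff r (coeff s (inV R g * inU R f)) = coeff s g * coeff r f := by
  simp [inU, inV]

theorem commute_inU_inV {f g : R⟦X⟧} (h : ∀ r s, Commute (coeff r f) (coeff s g)) :
    Commute (inU R f) (inV R g) := by
  ext s r
  rw [coeff_coeff_inU_mul_inV, coeff_coeff_inV_mul_inU, (h r s).eq]

theorem commute_C_X (F : R⟦X⟧⟦X⟧) : Commute (C X) F := by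
  ext s : 1
  rw [coeff_C_mul, coeff_mul_C, (commute_X (coeff s F)).eq]

theorem commute_C_X_mul_X (F : R⟦X⟧⟦X⟧) : Commute (C X * X) F :=
  (commute_C_X F).mul_left (commute_X F).symm

end Semiring

variable [Ring R]

theorem commute_X_sub_C_X (F : R⟦X⟧⟦X⟧) : Commute (X - C X) F :=
  (commute_X F).symm.sub_left (commute_C_X F)

/-- In the conventions of `inU`, the equation is `(v⁻¹ - u⁻¹) F = u⁻¹ v⁻¹ G`, that is,
`(u - v) F = G`. -/
theorem X_sub_C_X_mul_eq_iff {F G : R⟦X⟧⟦X⟧} :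
    (X - C X) * F = C X * X * G ↔
      (∀ r, coeff r (coeff 0 F) = 0) ∧ (∀ s, coeff 0 (coeff s F) = 0) ∧
        ∀ r s, coeff (r + 1) (coeff s F) - coeff r (coeff (s + 1) F) = coeff r (coeff s G) := by
  simp only [PowerSeries.ext_iff, sub_mul, mul_assoc, map_sub, coeff_C_mul]
  constructor
  · intro h
    refine ⟨fun r => ?_, fun s => ?_, fun r s => ?_⟩
    · simpa [coeff_zero_X_mul, coeff_succ_X_mul] using h 0 (r + 1)
    · simpa [coeff_zero_X_mul, coeff_succ_X_mul] using h (s + 1) 0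
    · simpa [coeff_zero_X_mul, coeff_succ_X_mul] using h (s + 1) (r + 1)
  · rintro ⟨h₁, h₂, h₃⟩ (_ | s) (_ | r)
    · simp
    · simpa [coeff_zero_X_mul, coeff_succ_X_mul] using h₁ r
    · simpa [coeff_zero_X_mul, coeff_succ_X_mul] using h₂ s
    · simpa [coeff_zero_X_mul, coeff_succ_X_mul] using h₃ r s

end TwoVariables

section MatrixSeries

variable {ι R : Type*} [Fintype ι] [DecidableEq ι]

variable (ι R) in
/-- The identification of matrices of series with series of matrices. -/
def matrixSeriesEquiv [Semiring R] : Matrix ι ι R⟦X⟧ ≃+* (Matrix ι ι R)⟦X⟧ where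
  toFun M := PowerSeries.mk fun r => M.map (coeff r)
  invFun φ := of fun i j => PowerSeries.mk fun r => coeff r φ i j
  left_inv M := by ext; simp
  right_inv φ := by ext; simp
  map_mul' M N := by
    ext r i j
    simp only [coeff_mk, coeff_mul, map_apply, mul_apply, map_sum, Matrix.sum_apply]
    exact Finset.sum_comm
  map_add' M N := by ext; simp

theorem isUnit_iff_isUnit_map_constantCoeff [Ring R] {M : Matrix ι ι R⟦X⟧} :
    IsUnit M ↔ IsUnit (M.map constantCoeff) := by
  rw [← MulEquiv.isUnit_map (matrixSeriesEquiv ι R), PowerSeries.isUnit_iff_constantCoeff]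
  congr!
  ext i j
  simp [matrixSeriesEquiv]

variable [Ring R]

/-- The substitution `f(u) ↦ f(-u)`. Mathlib's `PowerSeries.evalNegHom` requires commuting
coefficients. -/
def evalNeg : R⟦X⟧ →+* R⟦X⟧ where
  toFun f := PowerSeries.mk fun r => (-1 : ℤ) ^ r • coeff r f
  map_zero' := by ext; simp
  map_one' := by ext (_ | r) <;> simp [coeff_one]
  map_add' f g := by ext; simp
  map_mul' f g := by
    ext r
    simp only [coeff_mk, coeff_mul, Finset.smul_sum, smul_mul_smul_comm, ← pow_add]
    exact Finset.sum_congr rfl fun p hp => by rw [Finset.HasAntidiagonal.mem_antidiagonal.1 hp]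

theorem coeff_evalNeg (f : R⟦X⟧) (r : ℕ) : coeff r (evalNeg f) = (-1 : ℤ) ^ r • coeff r f := by
  simp [evalNeg]

theorem evalNeg_evalNeg (f : R⟦X⟧) : evalNeg (evalNeg f) = f := by
  ext r
  rw [coeff_evalNeg, coeff_evalNeg, smul_smul, ← mul_pow, neg_one_mul, neg_neg, one_pow, one_smul]

theorem map_evalNeg {S : Type*} [Ring S] (φ : R →+* S) (f : R⟦X⟧) :
    PowerSeries.map φ (evalNeg f) = evalNeg (PowerSeries.map φ f) := by
  ext r
  simp [coeff_evalNeg]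

end MatrixSeries

section Opposite

open MulOpposite

variable {ι R : Type*} [DecidableEq ι] [Semiring R]

/-- A series over `R`, viewed as a series over the opposite ring. -/
def opCoeff (f : R⟦X⟧) : Rᵐᵒᵖ⟦X⟧ :=
  PowerSeries.mk fun r => op (coeff r f)

theorem coeff_opCoeff (f : R⟦X⟧) (r : ℕ) : coeff r (opCoeff f) = op (coeff r f) :=
  coeff_mk _ _

theorem map_constantCoeff_map_opCoeff {M : Matrix ι ι R⟦X⟧} (hM : M.map constantCoeff = 1) :
    (M.map opCoeff).map constantCoeff = 1 := by
  ext i j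
  have := congrFun₂ hM i j
  rw [map_apply, ← coeff_zero_eq_constantCoeff_apply] at this
  rw [map_apply, map_apply, ← coeff_zero_eq_constantCoeff_apply, coeff_opCoeff, this, one_apply,
    one_apply, apply_ite op, op_one, op_zero]

end Opposite

section IsRTT

open MulOpposite

variable {ι R : Type*} [Fintype ι] [DecidableEq ι] [Ring R]

/-- A matrix `M(u)` of series with constant term `1` is an RTT matrix if
`R(u - v) M₁(u) M₂(v) = M₂(v) M₁(u) R(u - v)`, where `R(u) = u - P`. The relation is multiplied by
`u⁻¹ v⁻¹`, so that it makes sense for series in `u⁻¹` and `v⁻¹`. -/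
structure IsRTT (M : Matrix ι ι R⟦X⟧) : Prop where
  map_constantCoeff : M.map constantCoeff = 1
  rtt : SemiconjBy (rMatrix ι (X - C X) (C X * X))
    (leftFactor _ _ ((inU R).mapMatrix M) * rightFactor _ _ ((inV R).mapMatrix M))
    (rightFactor _ _ ((inV R).mapMatrix M) * leftFactor _ _ ((inU R).mapMatrix M))

theorem isRTT_iff {M : Matrix ι ι R⟦X⟧} :
    IsRTT M ↔ M.map constantCoeff = 1 ∧ ∀ i j k l r s,
      ⁅coeff (r + 1) (M i j), coeff s (M k l)⁆ - ⁅coeff r (M i j), coeff (s + 1) (M k l)⁆ =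
        coeff r (M k j) * coeff s (M i l) - coeff s (M k j) * coeff r (M i l) := by
  have commute_coeff_zero (hM : M.map constantCoeff = 1) (i j : ι) (a : R) :
      Commute (coeff 0 (M i j)) a := by
    rw [coeff_zero_eq_constantCoeff_apply, ← map_apply (f := constantCoeff), hM, one_apply]
    split_ifs
    exacts [.one_left a, .zero_left a]
  refine (show IsRTT M ↔ _ ∧ _ from ⟨fun h => ⟨h.1, h.2⟩, fun h => ⟨h.1, h.2⟩⟩).trans
    (and_congr_right fun hM => ?_)
  rw [semiconjBy_rMatrix_iff commute_X_sub_C_X commute_C_X_mul_X]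
  simp only [leftFactor_mul_rightFactor_apply, rightFactor_mul_leftFactor_apply,
    RingHom.mapMatrix_apply, map_apply, X_sub_C_X_mul_eq_iff, map_sub, coeff_coeff_inU_mul_inV,
    coeff_coeff_inV_mul_inU, Ring.lie_def, (commute_coeff_zero hM _ _ _).eq, sub_self,
    implies_true, true_and]

theorem IsRTT.one : IsRTT (1 : Matrix ι ι R⟦X⟧) where
  map_constantCoeff := map_one (constantCoeff (R := R)).mapMatrix
  rtt := by simp only [map_one, mul_one, SemiconjBy.one_right]

theorem IsRTT.mul {M N : Matrix ι ι R⟦X⟧} (hM : IsRTT M) (hN : IsRTT N)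
    (h : ∀ i j k l r s, Commute (coeff r (M i j)) (coeff s (N k l))) : IsRTT (M * N) where
  map_constantCoeff := by
    rw [← RingHom.mapMatrix_apply, map_mul, RingHom.mapMatrix_apply, RingHom.mapMatrix_apply,
      hM.map_constantCoeff, hN.map_constantCoeff, mul_one]
  rtt := by
    have comm₁₂ : Commute (leftFactor _ _ ((inU R).mapMatrix M))
        (rightFactor _ _ ((inV R).mapMatrix N)) :=
      commute_leftFactor_rightFactor fun i j k l => commute_inU_inV (h i j k l)
    have comm₂₁ : Commute (leftFactor _ _ ((inU R).mapMatrix N))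
        (rightFactor _ _ ((inV R).mapMatrix M)) :=
      commute_leftFactor_rightFactor fun i j k l => commute_inU_inV fun r s => (h k l i j s r).symm
    simpa only [map_mul, comm₁₂.mul_mul_mul_comm, comm₂₁.mul_mul_mul_comm] using!
      hM.rtt.mul_right hN.rtt

theorem IsRTT.map {S : Type*} [Ring S] {M : Matrix ι ι R⟦X⟧} (hM : IsRTT M) (f : R →+* S) :
    IsRTT ((PowerSeries.map f).mapMatrix M) := by
  rw [isRTT_iff] at hM ⊢
  refine ⟨?_, fun i j k l r s => ?_⟩
  · rw [← map_one f.mapMatrix, ← hM.1]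
    ext i j
    simp only [← coeff_zero_eq_constantCoeff_apply, RingHom.mapMatrix_apply, map_apply, coeff_map]
  · simpa only [Ring.lie_def, map_sub, map_mul, RingHom.mapMatrix_apply, map_apply,
      coeff_map] using congrArg f (hM.2 i j k l r s)

theorem IsRTT.isUnit {M : Matrix ι ι R⟦X⟧} (hM : IsRTT M) : IsUnit M := by
  rw [isUnit_iff_isUnit_map_constantCoeff, hM.map_constantCoeff]
  exact isUnit_one

theorem IsRTT.op_inv {M : (Matrix ι ι R⟦X⟧)ˣ} (hM : IsRTT (M : Matrix ι ι R⟦X⟧)) :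
    IsRTT ((↑M⁻¹ : Matrix ι ι R⟦X⟧).map opCoeff) := by
  refine isRTT_iff.2 ⟨map_constantCoeff_map_opCoeff ?_, fun i j k l r s => ?_⟩
  · have map_M : Units.map (constantCoeff (R := R)).mapMatrix.toMonoidHom M = 1 :=
      Units.ext hM.map_constantCoeff
    have map_inv_M : Units.map (constantCoeff (R := R)).mapMatrix.toMonoidHom M⁻¹ = 1 := by
      rw [map_inv, map_M, inv_one]
    exact congrArg Units.val map_inv_M
  · let M₁ := Units.map ((leftFactor ι _).comp (inU R).mapMatrix).toMonoidHom M
    let M₂ := Units.map ((rightFactor ι _).comp (inV R).mapMatrix).toMonoidHom M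
    have h : SemiconjBy (rMatrix ι (X - C X) (C X * X)) (M₁ * M₂ : _ˣ).1 (M₂ * M₁ : _ˣ).1 := hM.rtt
    have h_inv := h.units_inv_right
    rw [_root_.mul_inv_rev, _root_.mul_inv_rev, ← map_inv, ← map_inv] at h_inv
    have := (X_sub_C_X_mul_eq_iff.1 ((semiconjBy_rMatrix_iff commute_X_sub_C_X
      commute_C_X_mul_X).1 h_inv i j k l)).2.2 r s
    simp only [Units.val_mul, Units.coe_map, MonoidHom.coe_coe, RingHom.toMonoidHom_eq_coe,
      RingHom.comp_apply, RingHom.mapMatrix_apply, leftFactor_mul_rightFactor_apply,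
      rightFactor_mul_leftFactor_apply, map_apply, map_sub, coeff_coeff_inU_mul_inV,
      coeff_coeff_inV_mul_inU] at this
    simp only [map_apply, coeff_opCoeff, Ring.lie_def, ← op_mul, ← op_sub, this]

theorem IsRTT.op_neg {M : Matrix ι ι R⟦X⟧} (hM : IsRTT M) :
    IsRTT ((evalNeg.mapMatrix M).map opCoeff) := by
  refine isRTT_iff.2 ⟨map_constantCoeff_map_opCoeff ?_, fun i j k l r s => ?_⟩
  · rw [← hM.map_constantCoeff]
    ext i j
    simp only [RingHom.mapMatrix_apply, map_apply, ← coeff_zero_eq_constantCoeff_apply,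
      coeff_evalNeg, pow_zero, one_smul]
  · have h := congrArg op ((isRTT_iff.1 hM).2 k l i j s r)
    simp only [Ring.lie_def, op_sub, op_mul] at h
    simp only [RingHom.mapMatrix_apply, map_apply, coeff_opCoeff, coeff_evalNeg, op_smul,
      Ring.lie_def, smul_mul_smul_comm, ← pow_add]
    linear_combination (norm := module) ((-1 : ℤ) ^ (r + s)) • h

end IsRTT

section Antipode

open Algebra Coalgebra TensorProduct

variable {R A : Type*} [CommSemiring R] [Semiring A] [Bialgebra R A] {S : A →ₗ[R] A} {x y : A}

/-- The antipode axioms for `S`, evaluated at one element `x`: if `Δ(x) = ∑ x₁ ⊗ x₂`, then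
`∑ S(x₁) x₂ = ε(x) = ∑ x₁ S(x₂)`. -/
structure IsAntipodeAt (S : A →ₗ[R] A) (x : A) : Prop where
  left : LinearMap.mul' R A (S.rTensor A (comul x)) = algebraMap R A (counit x)
  right : LinearMap.mul' R A (S.lTensor A (comul x)) = algebraMap R A (counit x)

theorem isAntipodeAt_algebraMap (hS : S 1 = 1) (c : R) : IsAntipodeAt S (algebraMap R A c) := by
  constructor <;> simp [Algebra.algebraMap_eq_smul_one, Algebra.TensorProduct.one_def, hS]

theorem IsAntipodeAt.add (hx : IsAntipodeAt S x) (hy : IsAntipodeAt S y) :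
    IsAntipodeAt S (x + y) where
  left := by simp only [map_add, hx.left, hy.left]
  right := by simp only [map_add, hx.right, hy.right]

theorem IsAntipodeAt.mul (hS : ∀ a b, S (a * b) = S b * S a) (hx : IsAntipodeAt S x)
    (hy : IsAntipodeAt S y) : IsAntipodeAt S (x * y) := by
  let p := ℛ R x
  let q := ℛ R y
  obtain ⟨x_left, x_right⟩ := hx
  obtain ⟨y_left, y_right⟩ := hy
  simp only [← p.eq, ← q.eq, map_sum, LinearMap.rTensor_tmul, LinearMap.lTensor_tmul,
    LinearMap.mul'_apply] at x_left x_right y_left y_right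
  have comul_mul : comul (R := R) (x * y) =
      ∑ i ∈ p.index, ∑ j ∈ q.index, (p.left i * q.left j) ⊗ₜ (p.right i * q.right j) := by
    simp only [Bialgebra.comul_mul, ← p.eq, ← q.eq, Finset.sum_mul_sum,
      Algebra.TensorProduct.tmul_mul_tmul]
  constructor
  · calc LinearMap.mul' R A (S.rTensor A (comul (x * y)))
        = ∑ j ∈ q.index, S (q.left j) * (∑ i ∈ p.index, S (p.left i) * p.right i) *
            q.right j := by
          simp only [comul_mul, map_sum, LinearMap.rTensor_tmul, LinearMap.mul'_apply, hS,
            Finset.mul_sum, Finset.sum_mul, mul_assoc]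
          exact Finset.sum_comm
      _ = algebraMap R A (counit (x * y)) := by
          simp only [x_left, ← Algebra.commutes (counit x), mul_assoc, ← Finset.mul_sum, y_left,
            Bialgebra.counit_mul, map_mul]
  · calc LinearMap.mul' R A (S.lTensor A (comul (x * y)))
        = ∑ i ∈ p.index, p.left i * (∑ j ∈ q.index, q.left j * S (q.right j)) *
            S (p.right i) := by
          simp only [comul_mul, map_sum, LinearMap.lTensor_tmul, LinearMap.mul'_apply, hS,
            Finset.mul_sum, Finset.sum_mul, mul_assoc]
      _ = algebraMap R A (counit (x * y)) := by
          simp only [y_right, mul_assoc, Algebra.commutes (counit y)]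
          simp only [← mul_assoc, ← Finset.sum_mul, x_right, Bialgebra.counit_mul, map_mul]

variable (S) in
/-- A Hopf algebra structure from an anti-multiplicative map that satisfies the antipode axioms on
a set of generators. -/
abbrev hopfAlgebraOfAdjoin {s : Set A} (hs : Algebra.adjoin R s = ⊤) (hS_one : S 1 = 1)
    (hS_mul : ∀ a b, S (a * b) = S b * S a) (h : ∀ x ∈ s, IsAntipodeAt S x) :
    HopfAlgebra R A :=
  have isAntipodeAt (x : A) : IsAntipodeAt S x :=
    Algebra.adjoin_induction (p := fun x _ => IsAntipodeAt S x) h (isAntipodeAt_algebraMap hS_one)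
      (fun _ _ _ _ => .add) (fun _ _ _ _ => .mul hS_mul) (hs ▸ Algebra.mem_top : x ∈ adjoin R s)
  { antipode := S
    mul_antipode_rTensor_comul := LinearMap.ext fun x => (isAntipodeAt x).left
    mul_antipode_lTensor_comul := LinearMap.ext fun x => (isAntipodeAt x).right }

end Antipode

attribute [local instance] Yangian.algebra

section Generators

variable {n : ℕ} {B C : Type*} [Semiring B] [Algebra ℂ B] [Semiring C] [Algebra ℂ C]

theorem map_freeGen_zero (f : Free n →ₐ[ℂ] B) (i j : Fin n) :
    f (freeGen i j 0) = (1 : Matrix (Fin n) (Fin n) B) i j := by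
  rw [freeGen, one_apply, apply_ite f, map_one, map_zero]

variable (n) in
/-- The quotient map from the free algebra onto the Yangian. -/
def quot : Free n →ₐ[ℂ] Yangian n :=
  RingQuot.mkAlgHom ℂ (Rel n)

theorem quot_freeGen (i j : Fin n) (r : ℕ) : quot n (freeGen i j r) = gen i j r :=
  RingHom.congr_fun (RingQuot.mkAlgHom_coe ℂ (Rel n)) (freeGen i j r)

variable (n) in
theorem adjoin_range_gen :
    Algebra.adjoin ℂ (Set.range fun p : Fin n × Fin n × ℕ => gen p.1 p.2.1 p.2.2) = ⊤ := by
  rw [← top_le_iff, ← (AlgHom.range_eq_top (quot n)).2 (RingQuot.mkAlgHom_surjective ℂ (Rel n)),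
    ← Algebra.map_top, ← FreeAlgebra.adjoin_range_ι, AlgHom.map_adjoin]
  refine Algebra.adjoin_mono ?_
  rintro _ ⟨_, ⟨⟨i, j, r⟩, rfl⟩, rfl⟩
  exact ⟨(i, j, r + 1), (quot_freeGen i j (r + 1)).symm⟩

theorem coeff_T (i j : Fin n) (r : ℕ) : coeff r (T n i j) = gen i j r := by
  rw [T, of_apply, coeff_mk]

/-- The image of `T(u)` under a homomorphism. -/
def mapT (f : Yangian n →ₐ[ℂ] B) : Matrix (Fin n) (Fin n) B⟦X⟧ :=
  (PowerSeries.map (f : Yangian n →+* B)).mapMatrix (T n)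

theorem coeff_mapT (f : Yangian n →ₐ[ℂ] B) (i j : Fin n) (r : ℕ) :
    coeff r (mapT f i j) = f (gen i j r) := by
  rw [mapT, RingHom.mapMatrix_apply, map_apply, coeff_map, coeff_T, RingHom.coe_coe]

theorem mapCoeff_T {B : Type} [Semiring B] [Algebra ℂ B] (f : Yangian n →ₐ[ℂ] B) :
    Matrix.mapCoeff f (T n) = mapT f := by
  ext i j r
  rw [Matrix.mapCoeff, of_apply, coeff_mk, coeff_T, coeff_mapT]

theorem mapT_injective : Function.Injective (mapT (n := n) (B := B)) := by
  refine fun f g h => AlgHom.ext_of_adjoin_eq_top (adjoin_range_gen n) ?_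
  rintro _ ⟨⟨i, j, r⟩, rfl⟩
  rw [← coeff_mapT, h, coeff_mapT]

theorem mapT_id : mapT (AlgHom.id ℂ (Yangian n)) = T n := by
  ext i j r
  rw [coeff_mapT, coeff_T, AlgHom.id_apply]

theorem mapT_comp (g : B →ₐ[ℂ] C) (f : Yangian n →ₐ[ℂ] B) :
    mapT (g.comp f) = (PowerSeries.map (g : B →+* C)).mapMatrix (mapT f) := by
  ext i j r
  rw [coeff_mapT, RingHom.mapMatrix_apply, map_apply, coeff_map, coeff_mapT, AlgHom.comp_apply,
    RingHom.coe_coe]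

end Generators

section UniversalProperty

variable {n : ℕ} {B : Type*} [Ring B] [Algebra ℂ B]

variable (n) in
theorem isRTT_T : IsRTT (T n) := by
  refine isRTT_iff.2 ⟨?_, fun i j k l r s => ?_⟩
  · ext i j
    rw [map_apply, ← coeff_zero_eq_constantCoeff_apply, coeff_T, ← quot_freeGen, map_freeGen_zero]
  · have quot_rel : quot n _ = quot n _ := RingQuot.mkAlgHom_rel ℂ (Rel.rel i j k l r s)
    simpa only [Ring.lie_def, coeff_T, map_sub, map_mul, quot_freeGen] using quot_rel

theorem isRTT_mapT (f : Yangian n →ₐ[ℂ] B) : IsRTT (mapT f) :=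
  (isRTT_T n).map _

/-- The homomorphism from the free algebra that sends the positive coefficients of `T(u)` to those
of `M`. -/
def freeLift (M : Matrix (Fin n) (Fin n) B⟦X⟧) : Free n →ₐ[ℂ] B :=
  FreeAlgebra.lift ℂ fun p => coeff (p.2.2 + 1) (M p.1 p.2.1)

theorem freeLift_freeGen {M : Matrix (Fin n) (Fin n) B⟦X⟧} (hM : IsRTT M) (i j : Fin n) (r : ℕ) :
    freeLift M (freeGen i j r) = coeff r (M i j) := by
  cases r with
  | zero =>
    rw [map_freeGen_zero, ← hM.map_constantCoeff, map_apply, coeff_zero_eq_constantCoeff_apply]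
  | succ r => exact FreeAlgebra.lift_ι_apply _ _

theorem freeLift_rel {M : Matrix (Fin n) (Fin n) B⟦X⟧} (hM : IsRTT M) ⦃x y : Free n⦄
    (h : Rel n x y) : freeLift M x = freeLift M y := by
  obtain ⟨i, j, k, l, r, s⟩ := h
  simpa only [Ring.lie_def, map_sub, map_mul, freeLift_freeGen hM] using
    (isRTT_iff.1 hM).2 i j k l r s

/-- The universal property of the Yangian: an RTT matrix `M` over `B` gives the homomorphism
`T(u) ↦ M(u)`. -/
def lift {M : Matrix (Fin n) (Fin n) B⟦X⟧} (hM : IsRTT M) : Yangian n →ₐ[ℂ] B :=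
  RingQuot.liftAlgHom ℂ (s := Rel n) ⟨freeLift M, freeLift_rel hM⟩

theorem lift_gen {M : Matrix (Fin n) (Fin n) B⟦X⟧} (hM : IsRTT M) (i j : Fin n) (r : ℕ) :
    lift hM (gen i j r) = coeff r (M i j) := by
  rw [← quot_freeGen, ← freeLift_freeGen hM]
  exact RingQuot.liftAlgHom_mkAlgHom_apply ℂ _ (freeLift_rel hM) _

theorem mapT_lift {M : Matrix (Fin n) (Fin n) B⟦X⟧} (hM : IsRTT M) : mapT (lift hM) = M := by
  ext i j r
  rw [coeff_mapT, lift_gen]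

end UniversalProperty

section Bialgebra

open Algebra.TensorProduct

variable (n : ℕ) {B : Type*} [Semiring B] [Algebra ℂ B]

/-- The coproduct `T(u) ↦ T(u) ⊗ 1 · 1 ⊗ T(u)` of the Yangian. -/
def comul : Yangian n →ₐ[ℂ] Yangian n ⊗[ℂ] Yangian n :=
  lift ((isRTT_mapT (n := n) includeLeft).mul (isRTT_mapT includeRight) fun i j k l r s => by
    rw [coeff_mapT, coeff_mapT]
    exact (Commute.one_right _).tmul (Commute.one_left _))

/-- The counit `T(u) ↦ 1` of the Yangian. -/
def counit : Yangian n →ₐ[ℂ] ℂ :=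
  lift .one

theorem mapT_comul : mapT (comul n) = mapT includeLeft * mapT includeRight :=
  mapT_lift _

theorem mapT_counit : mapT (counit n) = 1 :=
  mapT_lift _

theorem mapT_comp_comul (f : Yangian n ⊗[ℂ] Yangian n →ₐ[ℂ] B) :
    mapT (f.comp (comul n)) = mapT (f.comp includeLeft) * mapT (f.comp includeRight) := by
  rw [mapT_comp, mapT_comul, map_mul, ← mapT_comp, ← mapT_comp]

theorem mapT_comp_counit (f : ℂ →ₐ[ℂ] B) : mapT (f.comp (counit n)) = 1 := by
  rw [mapT_comp, mapT_counit, map_one]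

theorem comul_coassoc :
    (Algebra.TensorProduct.assoc ℂ ℂ ℂ (Yangian n) (Yangian n) (Yangian n)).toAlgHom.comp
        ((Algebra.TensorProduct.map (comul n) (.id ℂ (Yangian n))).comp (comul n)) =
      (Algebra.TensorProduct.map (.id ℂ (Yangian n)) (comul n)).comp (comul n) := by
  apply mapT_injective
  let α := (Algebra.TensorProduct.assoc ℂ ℂ ℂ (Yangian n) (Yangian n) (Yangian n)).toAlgHom
  let T₁ := mapT (n := n) (includeLeft : _ →ₐ[ℂ] Yangian n ⊗[ℂ] (Yangian n ⊗[ℂ] Yangian n))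
  let T₂ := mapT (n := n) ((includeRight : _ →ₐ[ℂ] Yangian n ⊗[ℂ] _).comp
    (includeLeft : _ →ₐ[ℂ] Yangian n ⊗[ℂ] Yangian n))
  let T₃ := mapT (n := n) ((includeRight : _ →ₐ[ℂ] Yangian n ⊗[ℂ] _).comp
    (includeRight : _ →ₐ[ℂ] Yangian n ⊗[ℂ] Yangian n))
  trans T₁ * T₂ * T₃
  · have left : (α.comp (Algebra.TensorProduct.map (comul n) (.id ℂ (Yangian n)))).comp
        includeLeft = (α.comp includeLeft).comp (comul n) := by
      ext x; simp
    have right : (α.comp (Algebra.TensorProduct.map (comul n) (.id ℂ (Yangian n)))).comp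
        includeRight = includeRight.comp includeRight :=
      AlgHom.ext fun x => by simp [α, one_def]
    rw [← AlgHom.comp_assoc, mapT_comp_comul, left, right, mapT_comp_comul]
    congr 3
  · have left : (Algebra.TensorProduct.map (.id ℂ (Yangian n)) (comul n)).comp includeLeft =
        includeLeft := by
      ext x; simp
    have right : (Algebra.TensorProduct.map (.id ℂ (Yangian n)) (comul n)).comp includeRight =
        (includeRight : _ →ₐ[ℂ] Yangian n ⊗[ℂ] (Yangian n ⊗[ℂ] Yangian n)).comp (comul n) := by
      ext x; simp
    rw [mapT_comp_comul, left, right, mapT_comp_comul, mul_assoc]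

theorem map_counit_id_comp_comul :
    (Algebra.TensorProduct.map (counit n) (.id ℂ (Yangian n))).comp (comul n) =
      (Algebra.TensorProduct.lid ℂ (Yangian n)).symm := by
  apply mapT_injective
  have left : (Algebra.TensorProduct.map (counit n) (.id ℂ (Yangian n))).comp includeLeft =
      (includeLeft : ℂ →ₐ[ℂ] ℂ ⊗[ℂ] Yangian n).comp (counit n) := by
    ext x; simp
  rw [mapT_comp_comul, left, mapT_comp_counit, one_mul]
  congr 1
  ext x
  simp

theorem map_id_counit_comp_comul :
    (Algebra.TensorProduct.map (.id ℂ (Yangian n)) (counit n)).comp (comul n) =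
      (Algebra.TensorProduct.rid ℂ ℂ (Yangian n)).symm := by
  apply mapT_injective
  have right : (Algebra.TensorProduct.map (.id ℂ (Yangian n)) (counit n)).comp includeRight =
      (includeRight : ℂ →ₐ[ℂ] Yangian n ⊗[ℂ] ℂ).comp (counit n) := by
    ext x; simp
  rw [mapT_comp_comul, right, mapT_comp_counit, mul_one]
  congr 1
  ext x
  simp

/-- The bialgebra structure of the Yangian. -/
abbrev bialgebra : Bialgebra ℂ (Yangian n) :=
  Bialgebra.ofAlgHom (comul n) (counit n) (comul_coassoc n) (map_counit_id_comp_comul n)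
    (map_id_counit_comp_comul n)

end Bialgebra

section YangianAntipode

open MulOpposite

variable (n : ℕ)

/-- The matrix `T(u)` as an invertible matrix. -/
def unitT : (Matrix (Fin n) (Fin n) (Yangian n)⟦X⟧)ˣ :=
  (isRTT_T n).isUnit.unit

theorem val_unitT : (unitT n : Matrix (Fin n) (Fin n) (Yangian n)⟦X⟧) = T n :=
  (isRTT_T n).isUnit.unit_spec

/-- The antipode `T(u) ↦ T(u)⁻¹` of the Yangian, as a homomorphism to the opposite algebra. -/
def antipodeOp : Yangian n →ₐ[ℂ] (Yangian n)ᵐᵒᵖ :=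
  lift (IsRTT.op_inv (M := unitT n) (val_unitT n ▸ isRTT_T n))

/-- The anti-automorphism `T(u) ↦ T(-u)` of the Yangian, as a homomorphism to the opposite
algebra. -/
def negOp : Yangian n →ₐ[ℂ] (Yangian n)ᵐᵒᵖ :=
  lift (isRTT_T n).op_neg

/-- The automorphism `T(u) ↦ T(-u)⁻¹` of the Yangian. -/
def invNeg : Yangian n →ₐ[ℂ] Yangian n :=
  (AlgHom.opComm (antipodeOp n)).comp (negOp n)

/-- The antipode `T(u) ↦ T(u)⁻¹` of the Yangian, as a linear map. -/
def antipode : Yangian n →ₗ[ℂ] Yangian n :=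
  (opLinearEquiv ℂ).symm.toLinearMap ∘ₗ (antipodeOp n).toLinearMap

variable {n}

theorem op_antipode (x : Yangian n) : op (antipode n x) = antipodeOp n x := rfl

theorem unop_antipodeOp_gen (i j : Fin n) (r : ℕ) :
    (antipodeOp n (gen i j r)).unop = coeff r ((↑(unitT n)⁻¹ : Matrix _ _ _) i j) := by
  rw [antipodeOp, lift_gen, map_apply, coeff_opCoeff, unop_op]

theorem antipode_gen (i j : Fin n) (r : ℕ) :
    antipode n (gen i j r) = coeff r ((↑(unitT n)⁻¹ : Matrix _ _ _) i j) :=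
  unop_antipodeOp_gen i j r

theorem unop_negOp_gen (i j : Fin n) (r : ℕ) :
    (negOp n (gen i j r)).unop = (-1 : ℤ) ^ r • gen i j r := by
  rw [negOp, lift_gen, map_apply, coeff_opCoeff, unop_op, RingHom.mapMatrix_apply, map_apply,
    coeff_evalNeg, coeff_T]

variable (n)

theorem involutive_unop_negOp : Function.Involutive fun x => (negOp n x).unop := by
  have h : (AlgHom.opComm (negOp n)).comp (negOp n) = AlgHom.id ℂ _ := by
    apply mapT_injective
    ext i j r
    rw [coeff_mapT, coeff_mapT, AlgHom.id_apply]
    change (negOp n (negOp n (gen i j r)).unop).unop = gen i j r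
    rw [unop_negOp_gen, map_zsmul, unop_smul, unop_negOp_gen, smul_smul, ← mul_pow, neg_one_mul,
      neg_neg, one_pow, one_smul]
  exact DFunLike.congr_fun h

theorem mapT_invNeg :
    mapT (invNeg n) = evalNeg.mapMatrix (↑(unitT n)⁻¹ : Matrix _ _ _) := by
  ext i j r
  rw [coeff_mapT, RingHom.mapMatrix_apply, map_apply, coeff_evalNeg]
  change (antipodeOp n (negOp n (gen i j r)).unop).unop = _
  rw [unop_negOp_gen, map_zsmul, unop_smul, unop_antipodeOp_gen]

theorem involutive_invNeg : Function.Involutive (invNeg n) := by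
  suffices h : (invNeg n).comp (invNeg n) = AlgHom.id ℂ _ from DFunLike.congr_fun h
  apply mapT_injective
  let f := Units.map (PowerSeries.map (invNeg n : Yangian n →+* Yangian n)).mapMatrix.toMonoidHom
    (M := Matrix (Fin n) (Fin n) (Yangian n)⟦X⟧)
  let e := Units.map (evalNeg (R := Yangian n)).mapMatrix.toMonoidHom
    (M := Matrix (Fin n) (Fin n) (Yangian n)⟦X⟧)
  have f_unitT : f (unitT n) = e (unitT n)⁻¹ :=
    Units.ext ((congrArg _ (val_unitT n)).trans (mapT_invNeg n))
  have f_e (M) : f (e M) = e (f M) :=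
    Units.ext (by ext i j : 1; exact map_evalNeg (invNeg n).toRingHom _)
  have e_e (M) : e (e M) = M := Units.ext (by ext i j : 1; exact evalNeg_evalNeg _)
  have f_f_unitT : f (f (unitT n)) = unitT n := by
    rw [f_unitT, f_e, map_inv f, f_unitT, ← map_inv e, inv_inv, e_e]
  rw [mapT_comp, mapT_id, mapT, ← val_unitT]
  exact congrArg Units.val f_f_unitT

theorem antipodeOp_bijective : Function.Bijective (antipodeOp n) := by
  have antipodeOp_eq : ⇑(antipodeOp n) = op ∘ invNeg n ∘ fun x => (negOp n x).unop := by
    funext x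
    exact congrArg (antipodeOp n) (involutive_unop_negOp n x).symm
  rw [antipodeOp_eq]
  exact opEquiv.bijective.comp
    ((involutive_invNeg n).bijective.comp (involutive_unop_negOp n).bijective)

theorem mapCoeff_antipode_T :
    Matrix.mapCoeff (antipode n) (T n) = (↑(unitT n)⁻¹ : Matrix _ _ _) := by
  ext i j r
  rw [Matrix.mapCoeff, of_apply, coeff_mk, coeff_T, antipode_gen]

theorem T_mul_mapCoeff_antipode_T : T n * Matrix.mapCoeff (antipode n) (T n) = 1 := by
  rw [mapCoeff_antipode_T, ← val_unitT, (unitT n).mul_inv]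

theorem mapCoeff_antipode_T_mul_T : Matrix.mapCoeff (antipode n) (T n) * T n = 1 := by
  rw [mapCoeff_antipode_T, ← val_unitT, (unitT n).inv_mul]

attribute [local instance] Yangian.bialgebra

variable {n} in
theorem comul_gen (i j : Fin n) (r : ℕ) :
    Coalgebra.comul (R := ℂ) (gen i j r) =
      ∑ a, ∑ p ∈ Finset.HasAntidiagonal.antidiagonal r, gen i a p.1 ⊗ₜ[ℂ] gen a j p.2 := by
  change comul n _ = _
  rw [← coeff_mapT, mapT_comul, mul_apply, map_sum]
  simp [coeff_mul, coeff_mapT]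

variable {n} in
theorem algebraMap_counit_gen (i j : Fin n) (r : ℕ) :
    algebraMap ℂ (Yangian n) (Coalgebra.counit (gen i j r)) =
      coeff r ((1 : Matrix (Fin n) (Fin n) (Yangian n)⟦X⟧) i j) := by
  change Algebra.ofId ℂ (Yangian n) (counit n _) = _
  rw [← AlgHom.comp_apply, ← coeff_mapT, mapT_comp_counit]

variable {n} in
theorem isAntipodeAt_gen (i j : Fin n) (r : ℕ) : IsAntipodeAt (antipode n) (gen i j r) where
  left := by
    rw [algebraMap_counit_gen, comul_gen, ← (unitT n).inv_mul, val_unitT, mul_apply]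
    simp [coeff_mul, coeff_T, antipode_gen]
  right := by
    rw [algebraMap_counit_gen, comul_gen, ← (unitT n).mul_inv, val_unitT, mul_apply]
    simp [coeff_mul, coeff_T, antipode_gen]

/-- The Hopf algebra structure of the Yangian. -/
abbrev hopfAlgebra : HopfAlgebra ℂ (Yangian n) :=
  hopfAlgebraOfAdjoin (antipode n) (adjoin_range_gen n)
    (op_injective (by rw [op_antipode, map_one, op_one]))
    (fun a b => op_injective (by simp only [op_mul, op_antipode, map_mul]))
    (by rintro _ ⟨⟨i, j, r⟩, rfl⟩; exact isAntipodeAt_gen i j r)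

end YangianAntipode

end Yangian

end

theorem mainTheorem3 (n : ℕ) :
    ∃ H : HopfAlgebra ℂ (Yangian n),
      -- the underlying algebra is the Yangian
      H.toAlgebra = Yangian.algebra n ∧
      -- the antipode is an anti-automorphism
      (∃ S : Yangian n ≃ₐ[ℂ] (Yangian n)ᵐᵒᵖ,
        ∀ y : Yangian n, S y = MulOpposite.op (HopfAlgebra.antipode ℂ y)) ∧
      -- coproduct
      (∀ i j : Fin n,
        Matrix.mapCoeff (Coalgebra.comul (R := ℂ) (A := Yangian n)) (Yangian.T n) i j =
          ∑ a : Fin n,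
            PowerSeries.map
                (Algebra.TensorProduct.includeLeftRingHom :
                  Yangian n →+* Yangian n ⊗[ℂ] Yangian n)
                (Yangian.T n i a) *
              PowerSeries.map
                ((Algebra.TensorProduct.includeRight :
                  Yangian n →ₐ[ℂ] Yangian n ⊗[ℂ] Yangian n) :
                  Yangian n →+* Yangian n ⊗[ℂ] Yangian n)
                (Yangian.T n a j)) ∧
      -- antipode: the image of `T(u)` is the two-sided inverse of `T(u)`
      (Yangian.T n * Matrix.mapCoeff (HopfAlgebra.antipode ℂ) (Yangian.T n) = 1 ∧
        Matrix.mapCoeff (HopfAlgebra.antipode ℂ) (Yangian.T n) * Yangian.T n = 1) ∧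
      -- counit
      Matrix.mapCoeff (Coalgebra.counit (R := ℂ) (A := Yangian n)) (Yangian.T n) = 1 := by
  let := Yangian.algebra n
  refine ⟨Yangian.hopfAlgebra n, rfl, ⟨AlgEquiv.ofBijective (Yangian.antipodeOp n)
      (Yangian.antipodeOp_bijective n), fun _ => rfl⟩, fun i j => ?_,
    ⟨Yangian.T_mul_mapCoeff_antipode_T n, Yangian.mapCoeff_antipode_T_mul_T n⟩, ?_⟩
  · have mapCoeff_comul_T := (Yangian.mapCoeff_T _).trans (Yangian.mapT_comul n)
    exact congrFun₂ mapCoeff_comul_T i j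
  · exact (Yangian.mapCoeff_T _).trans (Yangian.mapT_counit n)
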